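/- **Setting.** Let $\Theta\subseteq\mathbb{R}^d$, let $\mu$ be a $\sigma$-finite measure on $\mathbb{R}^p$, and let $\{p_\theta:\theta\in\Theta\}$ be probability densities on $\mathbb{R}^p$ with respect to $\mu$, jointly measurable in $(\theta,x)$. Let $\mathcal G$ be the set of all probability measures on $\Theta$, and for $g\in\mathcal G$ put $f_g(x)=\int_\Theta p_\theta(x)\,\mathrm{d}g(\theta)$. Fix $g_0\in\mathcal G$ and let $X_1,X_2,\dots$ be i.i.d. with density $f_{g_0}$ with respect to $\mu$. Write $\ell_n(f)=\sum_{i=1}^n\log f(X_i)\in[-\infty,\infty]$ and $$\chi^2(f,f_0)=\Big\|\frac{f}{f_0}-1\Big\|^2_{L_2(f_0\,\mathrm{d}\mu)}\in[0,\infty].$$ Let $\hat g=\hat g_n\in\mathcal G$ be a maximizer of $g\mapsto\ell_n(f_g)$ over $\mathcal G$ (any one; if there is none, $\hat g$ is an arbitrary element of $\mathcal G$). For $c\in\mathbb{R}$ put $$\mathcal G_n(c)=\{g\in\mathcal G:\ \ell_n(f_g)\ge\ell_n(f_{g_0})+c\}\cup\{\hat g\},\qquad L_n(\mathcal G,g_0)=2\Big\{\sup_{g\in\mathcal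 G}\ell_n(f_g)-\ell_n(f_{g_0})\Big\},$$ so that $L_n(\mathcal G,g_0)=2\{\ell_n(f_{\hat g})-\ell_n(f_{g_0})\}$ whenever a maximizer exists. **Theorem.** Assume that $\Theta$ is bounded and that, for every $g\in\mathcal G$, $\chi^2(f_g,f_{g_0})=0$ if and only if $g=g_0$. Suppose that $g_0$ is not a discrete distribution supported on finitely many points. Then for every $c>0$, $$\sup_{g\in\mathcal G_n(c)}n\,\chi^2(f_g,f_{g_0})\to\infty\quad\text{in probability as } n\to\infty.$$ Moreover, $L_n(\mathcal G,g_0)\to\infty$ in probability. Here $Y_n\to\infty$ in probability means that for every real $M$ the outer probability of $\{Y_n\le M\}$ tends to $0$. -/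

import Mathlib

open MeasureTheory ProbabilityTheory Filter Topology
open scoped ENNReal NNReal

noncomputable section

namespace NPMLE

/-- The mixture density `f_g(x) = ∫ p_θ(x) dg(θ)`, where the mixing distribution `g` is a
probability measure on the parameter set. -/
def mixDensity {T X : Type*} [MeasurableSpace T] (p : T → X → ℝ≥0) (g : ProbabilityMeasure T)
    (x : X) : ℝ≥0∞ :=
  ∫⁻ θ, (p θ x : ℝ≥0∞) ∂(g : Measure T)

/-- The chi-square divergence `χ²(f, f₀) = ‖f / f₀ - 1‖²` with the norm of `L²(f₀ dμ)`,
as an element of `[0, ∞]`. -/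
def chiSq {X : Type*} [MeasurableSpace X] (μ : Measure X) (f f₀ : X → ℝ≥0∞) : ℝ≥0∞ :=
  (eLpNorm (fun x => (f x / f₀ x).toReal - 1) 2 (μ.withDensity f₀)) ^ 2

/-- The log-likelihood `ℓ_n(f) = ∑_{i < n} log f(x_i)` of the first `n` observations, with values
in `[-∞, ∞]`, where `log 0 = -∞` and `log ∞ = ∞`. -/
def logLik {X : Type*} (x : ℕ → X) (n : ℕ) (f : X → ℝ≥0∞) : EReal :=
  ∑ i ∈ Finset.range n, ENNReal.log (f (x i))

/-- `g` maximizes `ℓ_n(f_g)` over all probability measures on the parameter set. -/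
def IsNPMLE {T X : Type*} [MeasurableSpace T] (p : T → X → ℝ≥0) (x : ℕ → X) (n : ℕ)
    (g : ProbabilityMeasure T) : Prop :=
  ∀ g' : ProbabilityMeasure T, logLik x n (mixDensity p g') ≤ logLik x n (mixDensity p g)

/-- The set `𝒢_n(c) = {g : ℓ_n(f_g) ≥ ℓ_n(f_{g₀}) + c} ∪ {ĝ}`. -/
def largeLik {T X : Type*} [MeasurableSpace T] (p : T → X → ℝ≥0) (g₀ : ProbabilityMeasure T)
    (x : ℕ → X) (n : ℕ) (c : ℝ) (ghat : ProbabilityMeasure T) : Set (ProbabilityMeasure T) :=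
  {g | logLik x n (mixDensity p g₀) + (c : EReal) ≤ logLik x n (mixDensity p g)} ∪ {ghat}

/-- The likelihood ratio statistic `L_n = 2 {sup_g ℓ_n(f_g) - ℓ_n(f_{g₀})}`; the supremum is
`ℓ_n(f_ĝ)` whenever a maximizer `ĝ` exists (see `lrStat_eq_of_isNPMLE`). -/
def lrStat {T X : Type*} [MeasurableSpace T] (p : T → X → ℝ≥0) (g₀ : ProbabilityMeasure T)
    (x : ℕ → X) (n : ℕ) : EReal :=
  2 * ((⨆ g : ProbabilityMeasure T, logLik x n (mixDensity p g)) - logLik x n (mixDensity p g₀))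

theorem lrStat_eq_of_isNPMLE {T X : Type*} [MeasurableSpace T] (p : T → X → ℝ≥0)
    (g₀ : ProbabilityMeasure T) (x : ℕ → X) (n : ℕ) (ghat : ProbabilityMeasure T)
    (h : IsNPMLE p x n ghat) :
    lrStat p g₀ x n = 2 * (logLik x n (mixDensity p ghat) - logLik x n (mixDensity p g₀)) := by
  have hs : (⨆ g : ProbabilityMeasure T, logLik x n (mixDensity p g))
      = logLik x n (mixDensity p ghat) :=
    le_antisymm (iSup_le h) (le_iSup (fun g => logLik x n (mixDensity p g)) ghat)
  rw [lrStat, hs]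

/-- `g` is discrete with finitely many support points. -/
def FinitelyDiscrete {T : Type*} [MeasurableSpace T] (g : ProbabilityMeasure T) : Prop :=
  ∃ S : Set T, S.Finite ∧ (g : Measure T) Sᶜ = 0

/-- `Y_n → ∞` in probability. The `Y_n` may be suprema over uncountable classes and need not be
measurable; `P` of an arbitrary set is its outer measure, so this says that the inner probability
of `{Y_n > M}` tends to one for every `M`. -/
def TendstoInftyInProb {Ω : Type*} [MeasurableSpace Ω] (P : Measure Ω) (Y : ℕ → Ω → EReal) :
    Prop :=
  ∀ M : ℝ, Tendsto (fun n => P {ω | Y n ω ≤ (M : EReal)}) atTop (𝓝 0)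

end NPMLE

end

/-!
If `g₀` is not finitely discrete, the model contains, through `g₀`, regular parametric submodels of
every finite dimension `K`, and the likelihood ratio statistic of such a submodel grows without
bound with `K`.

A bounded function `φ` with `∫ φ dg₀ = 0` perturbs `g₀` to the measure `tilt g₀ φ` of density
`1 + φ`, and the mixture density changes from `f₀` to `f₀ (1 + u)`, where the score
`u = E[φ(θ) | X]` is linear in `φ`, bounded by `sup |φ|` and centred. Identifiability says that the
score vanishes only if `φ` does (`ae_eq_zero_of_score_ae_eq_zero`). The support of `g₀` is infinite,
so there are `K` independent directions for every `K`, and the Gram–Schmidt process gives `K`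
directions with scores `u` orthonormal in `L²(f₀ dμ)` (`exists_orthonormal_scores`).

Let `S = ∑_{i < n} u(X_i) ∈ ℝ^K`. The off-diagonal part of `‖S‖²` has mean zero and variance at
most `2 K n²` (`integral_sq_offDiag`), while its diagonal part is close to `n K`. By Chebyshev's
inequality, `‖S‖² ≥ n K / 2` up to probability `32 / K + O(1 / n)`, and on the same event the
empirical Gram matrix of `u` is at most twice the identity (`measureReal_not_good_le`). No central
limit theorem is needed. On that event the direction `s = r S / (√n ‖S‖)` has
`n χ² = r²` and, as `log (1 + x) ≥ x - 2 x²` for `|x| ≤ 1 / 2`, a log-likelihood gain of at least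
`r √(K / 2) - 4 r²` (`exists_direction_log`). Taking `r` large first and then `K` makes both `n χ²`
and the gain as large as desired (`eventually_exists_large_logLik`), which gives both claims.
-/

open MeasureTheory ProbabilityTheory Filter Topology
open scoped ENNReal NNReal

noncomputable section

namespace NPMLE

/-! ### Second moments of sums of independent bounded variables -/

/-- The `σ`-algebra generated by the observations `X 0, …, X (n - 1)`. -/
@[reducible]
def past {Ω E : Type*} [MeasurableSpace E] (X : ℕ → Ω → E) (n : ℕ) : MeasurableSpace Ω :=
  ⨆ i ∈ Set.Iio n, MeasurableSpace.comap (X i) inferInstance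

section Moments

variable {Ω E : Type*} {X : ℕ → Ω → E}

lemma abs_sum_range_le {h : E → ℝ} {B : ℝ} (hB : ∀ x, |h x| ≤ B) (n : ℕ) (ω : Ω) :
    |∑ i ∈ Finset.range n, h (X i ω)| ≤ n * B :=
  (Finset.abs_sum_le_sum_abs _ _).trans
    ((Finset.sum_le_sum fun i _ => hB (X i ω)).trans_eq (by simp))

/-- The off-diagonal part `∑_{i ≠ i'} ⟨u(X_i), u(X_{i'})⟩` of `‖∑_{i < n} u(X_i)‖²`. -/
def offDiag {K : ℕ} (X : ℕ → Ω → E) (u : Fin K → E → ℝ) (n : ℕ) (ω : Ω) : ℝ :=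
  ∑ j, ((∑ i ∈ Finset.range n, u j (X i ω)) ^ 2 - ∑ i ∈ Finset.range n, u j (X i ω) ^ 2)

lemma offDiag_succ {K : ℕ} (u : Fin K → E → ℝ) (n : ℕ) (ω : Ω) :
    offDiag X u (n + 1) ω = offDiag X u n ω
      + ∑ j, 2 * ((∑ i ∈ Finset.range n, u j (X i ω)) * u j (X n ω)) := by
  rw [offDiag, offDiag, ← Finset.sum_add_distrib]
  refine Finset.sum_congr rfl fun j _ => ?_
  rw [Finset.sum_range_succ, Finset.sum_range_succ]; ring

lemma exists_bound_offDiag {K : ℕ} {u : Fin K → E → ℝ} {B : ℝ} (hB : ∀ j x, |u j x| ≤ B) (n : ℕ) :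
    ∃ C, ∀ ω, |offDiag X u n ω| ≤ C := by
  refine ⟨∑ _j : Fin K, ((n * B) ^ 2 + n * B ^ 2), fun ω => ?_⟩
  refine (Finset.abs_sum_le_sum_abs _ _).trans (Finset.sum_le_sum fun j _ => ?_)
  refine (abs_sub _ _).trans (add_le_add ?_ ?_)
  · rw [abs_pow]; gcongr; exact abs_sum_range_le (hB j) n ω
  · refine abs_sum_range_le (h := fun x => u j x ^ 2) (fun x => ?_) n ω
    rw [abs_pow]; gcongr; exact hB j x

variable [MeasurableSpace E]

lemma measurable_past {n i : ℕ} (hi : i < n) : Measurable[past X n] (X i) :=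
  Measurable.mono (comap_measurable (X i))
    (le_iSup₂_of_le (f := fun i (_ : i ∈ Set.Iio n) => MeasurableSpace.comap (X i) inferInstance)
      i hi le_rfl) le_rfl

lemma measurable_past_sum {n : ℕ} {h : E → ℝ} (hh : Measurable h) :
    Measurable[past X n] (fun ω => ∑ i ∈ Finset.range n, h (X i ω)) :=
  Finset.measurable_fun_sum _ fun _ hi =>
    hh.comp (measurable_past (Finset.mem_range.1 hi))

lemma measurable_past_offDiag {K : ℕ} {u : Fin K → E → ℝ} (hu : ∀ j, Measurable (u j)) (n : ℕ) :
    Measurable[past X n] (offDiag X u n) := by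
  refine Finset.measurable_fun_sum _ fun j _ => ?_
  refine Measurable.sub ((measurable_past_sum (hu j)).pow_const 2) ?_
  exact measurable_past_sum ((hu j).pow_const 2)

variable [MeasurableSpace Ω] {P : Measure Ω} {ν : Measure E}

lemma past_le (hX : ∀ i, Measurable (X i)) (n : ℕ) : past X n ≤ ‹MeasurableSpace Ω› :=
  iSup₂_le fun i _ => (hX i).comap_le

lemma integral_past_mul (hX : ∀ i, Measurable (X i)) (hind : iIndepFun X P)
    (hlaw : ∀ i, P.map (X i) = ν) {n : ℕ} {G : Ω → ℝ} (hG : Measurable[past X n] G)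
    {h : E → ℝ} (hh : Measurable h) :
    ∫ ω, G ω * h (X n ω) ∂P = (∫ ω, G ω ∂P) * ∫ x, h x ∂ν := by
  have h1 : Indep (past X n) (⨆ i ∈ ({n} : Set ℕ), MeasurableSpace.comap (X i) inferInstance) P :=
    indep_iSup_of_disjoint (fun i => (hX i).comap_le) hind (by simp)
  have h2 : IndepFun G (fun ω => h (X n ω)) P := by
    rw [IndepFun_iff_Indep]
    refine indep_of_indep_of_le_left (indep_of_indep_of_le_right h1 ?_) hG.comap_le
    simp only [Set.mem_singleton_iff, iSup_iSup_eq_left]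
    exact (hh.comp (comap_measurable (X n))).comap_le
  rw [h2.integral_fun_mul_eq_mul_integral
    (hG.mono (past_le hX n) le_rfl).aestronglyMeasurable
    (hh.comp (hX n)).aestronglyMeasurable, ← hlaw n,
    integral_map (hX n).aemeasurable hh.aestronglyMeasurable]

lemma integrable_of_measurable_of_bound [IsFiniteMeasure P] {f : Ω → ℝ} (hf : Measurable f) {C : ℝ}
    (h : ∀ ω, |f ω| ≤ C) : Integrable f P :=
  Integrable.of_bound hf.aestronglyMeasurable C (Eventually.of_forall h)

lemma measurable_sum_range (hX : ∀ i, Measurable (X i)) {h : E → ℝ} (hh : Measurable h) (n : ℕ) :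
    Measurable (fun ω => ∑ i ∈ Finset.range n, h (X i ω)) :=
  Finset.measurable_fun_sum _ fun i _ => hh.comp (hX i)

variable [IsProbabilityMeasure P]

/-- A sum of `n` i.i.d. centred variables has variance `n` times that of one of them. -/
lemma integral_sq_sum_range (hX : ∀ i, Measurable (X i)) (hind : iIndepFun X P)
    (hlaw : ∀ i, P.map (X i) = ν) {h : E → ℝ} (hh : Measurable h) {B : ℝ}
    (hB : ∀ x, |h x| ≤ B) (h0 : ∫ x, h x ∂ν = 0) (n : ℕ) :
    ∫ ω, (∑ i ∈ Finset.range n, h (X i ω)) ^ 2 ∂P = n * ∫ x, h x ^ 2 ∂ν := by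
  induction n with
  | zero => simp
  | succ n ih =>
    have hm := measurable_sum_range hX hh n
    have hb : ∀ ω, |∑ i ∈ Finset.range n, h (X i ω)| ≤ n * B := abs_sum_range_le hB n
    have hhn : Measurable fun ω => h (X n ω) := hh.comp (hX n)
    have e : ∀ ω, (∑ i ∈ Finset.range (n + 1), h (X i ω)) ^ 2
        = (∑ i ∈ Finset.range n, h (X i ω)) ^ 2
          + (2 * ((∑ i ∈ Finset.range n, h (X i ω)) * h (X n ω)) + h (X n ω) ^ 2) := by
      intro ω; rw [Finset.sum_range_succ]; ring
    have i1 : Integrable (fun ω => (∑ i ∈ Finset.range n, h (X i ω)) ^ 2) P :=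
      integrable_of_measurable_of_bound (hm.pow_const 2) (C := (n * B) ^ 2) fun ω => by
        rw [abs_pow]; gcongr; exact hb ω
    have i2 : Integrable (fun ω => (∑ i ∈ Finset.range n, h (X i ω)) * h (X n ω)) P :=
      integrable_of_measurable_of_bound (hm.mul hhn) (C := (n * B) * B) fun ω => by
        rw [abs_mul]; gcongr
        exacts [(abs_nonneg _).trans (hb ω), hb ω, hB _]
    have i3 : Integrable (fun ω => h (X n ω) ^ 2) P :=
      integrable_of_measurable_of_bound (hhn.pow_const 2) (C := B ^ 2) fun ω => by
        rw [abs_pow]; gcongr; exact hB _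
    have e3 : ∫ ω, h (X n ω) ^ 2 ∂P = ∫ x, h x ^ 2 ∂ν := by
      rw [← hlaw n, integral_map (hX n).aemeasurable (hh.pow_const 2).aestronglyMeasurable]
    have i4 : Integrable (fun ω => 2 * ((∑ i ∈ Finset.range n, h (X i ω)) * h (X n ω))
        + h (X n ω) ^ 2) P := (i2.const_mul 2).add i3
    simp_rw [e]
    rw [integral_add i1 i4, integral_add (i2.const_mul 2) i3,
      integral_const_mul, integral_past_mul hX hind hlaw (measurable_past_sum hh) hh, h0, ih, e3]
    push_cast; ring

/-- Chebyshev's inequality for a sum of i.i.d. centred bounded variables. -/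
lemma measureReal_le_abs_sum_range (hX : ∀ i, Measurable (X i)) (hind : iIndepFun X P)
    (hlaw : ∀ i, P.map (X i) = ν) {h : E → ℝ} (hh : Measurable h) {B : ℝ}
    (hB : ∀ x, |h x| ≤ B) (h0 : ∫ x, h x ∂ν = 0) {n : ℕ} (hn : 0 < n) {ε : ℝ} (hε : 0 < ε) :
    P.real {ω | n * ε ≤ |∑ i ∈ Finset.range n, h (X i ω)|} ≤ B ^ 2 / ε ^ 2 / n := by
  have : IsProbabilityMeasure ν := hlaw 0 ▸ Measure.isProbabilityMeasure_map (hX 0).aemeasurable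
  have hn' : (0 : ℝ) < n := by exact_mod_cast hn
  have hm := measurable_sum_range hX hh n
  have i1 : Integrable (fun ω => (∑ i ∈ Finset.range n, h (X i ω)) ^ 2) P :=
    integrable_of_measurable_of_bound (hm.pow_const 2) (C := (n * B) ^ 2) fun ω => by
      rw [abs_pow]; gcongr; exact abs_sum_range_le hB n ω
  have h1 := mul_meas_ge_le_integral_of_nonneg (μ := P)
    (Eventually.of_forall fun ω => sq_nonneg (∑ i ∈ Finset.range n, h (X i ω))) i1 ((n * ε) ^ 2)
  rw [integral_sq_sum_range hX hind hlaw hh hB h0] at h1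
  have h2 : ∫ x, h x ^ 2 ∂ν ≤ B ^ 2 := by
    have : ∫ x, h x ^ 2 ∂ν ≤ ∫ _, B ^ 2 ∂ν := by
      refine integral_mono (integrable_of_measurable_of_bound (hh.pow_const 2) (C := B ^ 2) ?_)
        (integrable_const _) ?_
      · intro x; rw [abs_pow]; gcongr; exact hB x
      · intro x; exact sq_le_sq' (abs_le.1 (hB x)).1 (abs_le.1 (hB x)).2
    simpa using this
  have h3 : {ω | n * ε ≤ |∑ i ∈ Finset.range n, h (X i ω)|}
      ⊆ {ω | (n * ε) ^ 2 ≤ (∑ i ∈ Finset.range n, h (X i ω)) ^ 2} := by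
    intro ω hω
    rw [Set.mem_ofPred_eq] at hω ⊢
    rw [← sq_abs (∑ i ∈ Finset.range n, h (X i ω))]
    gcongr
  have h4 := measureReal_mono (μ := P) h3
  rw [div_div, le_div_iff₀ (by positivity)]
  have h5 : (n * ε) ^ 2 * P.real {ω | n * ε ≤ |∑ i ∈ Finset.range n, h (X i ω)|} ≤ n * B ^ 2 :=
    (mul_le_mul_of_nonneg_left h4 (by positivity)).trans (h1.trans (by gcongr))
  nlinarith [h5]

variable {K : ℕ} {u : Fin K → E → ℝ}

/-- For orthonormal centred functions the off-diagonal part is a martingale whose increments have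
second moment `4 n K`. -/
lemma integral_sq_offDiag (hX : ∀ i, Measurable (X i)) (hind : iIndepFun X P)
    (hlaw : ∀ i, P.map (X i) = ν) (hu : ∀ j, Measurable (u j)) {B : ℝ}
    (hB : ∀ j x, |u j x| ≤ B) (h0 : ∀ j, ∫ x, u j x ∂ν = 0)
    (hon : ∀ j l, ∫ x, u j x * u l x ∂ν = if j = l then 1 else 0) (n : ℕ) :
    ∫ ω, offDiag X u n ω ^ 2 ∂P = 2 * K * n * (n - 1) := by
  induction n with
  | zero => simp [offDiag]
  | succ n ih =>
    set S : Fin K → Ω → ℝ := fun j ω => ∑ i ∈ Finset.range n, u j (X i ω) with hS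
    have hSm : ∀ j, Measurable (S j) := fun j => measurable_sum_range hX (hu j) n
    have hSp : ∀ j, Measurable[past X n] (S j) := fun j => measurable_past_sum (hu j)
    have hSb : ∀ j ω, |S j ω| ≤ n * B := fun j ω => abs_sum_range_le (hB j) n ω
    have hVp : Measurable[past X n] (offDiag X u n) := measurable_past_offDiag hu n
    have hVm : Measurable (offDiag X u n) := hVp.mono (past_le hX n) le_rfl
    obtain ⟨C, hC⟩ := exists_bound_offDiag (X := X) hB n
    have hun : ∀ j, Measurable fun ω => u j (X n ω) := fun j => (hu j).comp (hX n)
    have e : ∀ ω, offDiag X u (n + 1) ω ^ 2 = offDiag X u n ω ^ 2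
        + (∑ j, 4 * ((offDiag X u n ω * S j ω) * u j (X n ω))
          + ∑ j, ∑ l, 4 * ((S j ω * S l ω) * (u j (X n ω) * u l (X n ω)))) := by
      intro ω
      rw [offDiag_succ, add_sq, sq (∑ j, _), Finset.sum_mul_sum, Finset.mul_sum, add_assoc]
      congr 2
      · exact Finset.sum_congr rfl fun j _ => by simp only [hS]; ring
      · exact Finset.sum_congr rfl fun j _ => Finset.sum_congr rfl fun l _ => by
          simp only [hS]; ring
    have i1 : Integrable (fun ω => offDiag X u n ω ^ 2) P :=
      integrable_of_measurable_of_bound (hVm.pow_const 2) (C := C ^ 2) fun ω => by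
        rw [abs_pow]; gcongr; exact hC ω
    have i2 : ∀ j, Integrable (fun ω => 4 * ((offDiag X u n ω * S j ω) * u j (X n ω))) P := by
      intro j
      refine (integrable_of_measurable_of_bound ((hVm.mul (hSm j)).mul (hun j))
        (C := C * (n * B) * B) fun ω => ?_).const_mul 4
      have := (abs_nonneg _).trans (hC ω)
      have h2 := (abs_nonneg _).trans (hSb j ω)
      simp only [Pi.mul_apply, abs_mul]
      gcongr
      exacts [hC ω, hSb j ω, hB j _]
    have i3 : ∀ j l, Integrable
        (fun ω => 4 * ((S j ω * S l ω) * (u j (X n ω) * u l (X n ω)))) P := by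
      intro j l
      refine (integrable_of_measurable_of_bound (((hSm j).mul (hSm l)).mul ((hun j).mul (hun l)))
        (C := (n * B) * (n * B) * (B * B)) fun ω => ?_).const_mul 4
      have h2 := (abs_nonneg _).trans (hSb j ω)
      have h3 := (abs_nonneg _).trans (hB j (X n ω))
      simp only [Pi.mul_apply, abs_mul]
      gcongr
      exacts [hSb j ω, hSb l ω, hB j _, hB l _]
    have e2 : ∀ j, ∫ ω, 4 * ((offDiag X u n ω * S j ω) * u j (X n ω)) ∂P = 0 := by
      intro j
      rw [integral_const_mul, integral_past_mul hX hind hlaw 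
        (G := fun ω => offDiag X u n ω * S j ω) (hVp.mul (hSp j)) (hu j), h0]
      simp
    have e3 : ∀ j l, ∫ ω, 4 * ((S j ω * S l ω) * (u j (X n ω) * u l (X n ω))) ∂P
        = if j = l then 4 * (n : ℝ) else 0 := by
      intro j l
      rw [integral_const_mul, integral_past_mul hX hind hlaw
        (G := fun ω => S j ω * S l ω) ((hSp j).mul (hSp l))
        (h := fun x => u j x * u l x) ((hu j).mul (hu l)), hon]
      split_ifs with hjl
      · subst hjl
        have := integral_sq_sum_range hX hind hlaw (hu j) (hB j) (h0 j) n
        have h2 := hon j j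
        simp only [if_true, ← sq] at h2
        rw [h2] at this
        simp only [← sq, hS, this, mul_one]
      · simp
    have i4 : Integrable (fun ω => ∑ j, 4 * ((offDiag X u n ω * S j ω) * u j (X n ω))) P :=
      integrable_finsetSum _ fun j _ => i2 j
    have i5 : ∀ j, Integrable
        (fun ω => ∑ l, 4 * ((S j ω * S l ω) * (u j (X n ω) * u l (X n ω)))) P :=
      fun j => integrable_finsetSum _ fun l _ => i3 j l
    have i6 : Integrable
        (fun ω => ∑ j, ∑ l, 4 * ((S j ω * S l ω) * (u j (X n ω) * u l (X n ω)))) P :=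
      integrable_finsetSum _ fun j _ => i5 j
    have i7 : Integrable (fun ω => ∑ j, 4 * ((offDiag X u n ω * S j ω) * u j (X n ω))
        + ∑ j, ∑ l, 4 * ((S j ω * S l ω) * (u j (X n ω) * u l (X n ω)))) P := i4.add i6
    simp_rw [e]
    rw [integral_add i1 i7, integral_add i4 i6, integral_finsetSum _ fun j _ => i2 j,
      integral_finsetSum _ fun j _ => i5 j, ih]
    simp_rw [integral_finsetSum _ fun l _ => i3 _ l, e2, e3]
    simp
    ring

lemma measureReal_offDiag_le (hX : ∀ i, Measurable (X i)) (hind : iIndepFun X P)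
    (hlaw : ∀ i, P.map (X i) = ν) (hu : ∀ j, Measurable (u j)) {B : ℝ}
    (hB : ∀ j x, |u j x| ≤ B) (h0 : ∀ j, ∫ x, u j x ∂ν = 0)
    (hon : ∀ j l, ∫ x, u j x * u l x ∂ν = if j = l then 1 else 0) (hK : 0 < K) {n : ℕ}
    (hn : 0 < n) :
    P.real {ω | offDiag X u n ω ≤ -(n * K / 4)} ≤ 32 / K := by
  have hn' : (0 : ℝ) < n := by exact_mod_cast hn
  have hK' : (0 : ℝ) < K := by exact_mod_cast hK
  have hVm : Measurable (offDiag X u n) :=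
    (measurable_past_offDiag hu n).mono (past_le hX n) le_rfl
  obtain ⟨C, hC⟩ := exists_bound_offDiag (X := X) hB n
  have i1 : Integrable (fun ω => offDiag X u n ω ^ 2) P :=
    integrable_of_measurable_of_bound (hVm.pow_const 2) (C := C ^ 2) fun ω => by
      rw [abs_pow]; gcongr; exact hC ω
  have h1 := mul_meas_ge_le_integral_of_nonneg (μ := P)
    (Eventually.of_forall fun ω => sq_nonneg (offDiag X u n ω)) i1 ((n * K / 4) ^ 2)
  rw [integral_sq_offDiag hX hind hlaw hu hB h0 hon] at h1
  have h3 : {ω | offDiag X u n ω ≤ -(n * K / 4)} ⊆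
      {ω | (n * K / 4 : ℝ) ^ 2 ≤ offDiag X u n ω ^ 2} := by
    intro ω hω
    rw [Set.mem_ofPred_eq] at hω ⊢
    have : (0 : ℝ) ≤ n * K / 4 := by positivity
    nlinarith
  have h4 := measureReal_mono (μ := P) h3
  rw [le_div_iff₀ hK']
  have h5 : (n * K / 4 : ℝ) ^ 2 * P.real {ω | offDiag X u n ω ≤ -(n * K / 4)} ≤ 2 * K * n ^ 2 :=
    (mul_le_mul_of_nonneg_left h4 (by positivity)).trans (h1.trans (by nlinarith [mul_pos hK' hn']))
  have h6 : (0 : ℝ) < K * n ^ 2 := by positivity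
  nlinarith [h5]

omit [MeasurableSpace Ω] [MeasurableSpace E] in
/-- If the empirical Gram matrix is entrywise within `1 / K` of the identity, then its quadratic
form is at most twice the Euclidean one. -/
lemma sum_sq_le_of_gram_close {y : ℕ → Fin K → ℝ} {n : ℕ}
    (h : ∀ j l, |∑ i ∈ Finset.range n, (y i j * y i l - if j = l then 1 else 0)| ≤ n * (1 / K : ℝ))
    (hK : 0 < K) (s : Fin K → ℝ) :
    ∑ i ∈ Finset.range n, (∑ j, s j * y i j) ^ 2 ≤ 2 * n * ∑ j, s j ^ 2 := by
  have hK' : (0 : ℝ) < K := by exact_mod_cast hK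
  have e1 : ∀ i, (∑ j, s j * y i j) ^ 2
      = ∑ j, ∑ l, s j * s l * (y i j * y i l - if j = l then 1 else 0) + ∑ j, s j ^ 2 := by
    intro i
    rw [sq, Finset.sum_mul_sum, ← Finset.sum_add_distrib]
    refine Finset.sum_congr rfl fun j _ => ?_
    have : s j ^ 2 = ∑ l, s j * s l * (if j = l then 1 else 0) := by simp [sq]
    rw [this, ← Finset.sum_add_distrib]
    exact Finset.sum_congr rfl fun l _ => by ring
  simp_rw [e1, Finset.sum_add_distrib]
  rw [Finset.sum_comm]
  simp_rw [fun j => Finset.sum_comm (s := Finset.range n) (t := Finset.univ)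
    (f := fun i l => s j * s l * (y i j * y i l - if j = l then 1 else 0)), ← Finset.mul_sum]
  have e2 : ∑ j, ∑ l, s j * s l *
      ∑ i ∈ Finset.range n, (y i j * y i l - if j = l then 1 else 0)
      ≤ ∑ j, ∑ l, |s j| * |s l| * (n * (1 / K : ℝ)) := by
    refine Finset.sum_le_sum fun j _ => Finset.sum_le_sum fun l _ => ?_
    refine (le_abs_self _).trans ?_
    rw [abs_mul, abs_mul]
    exact mul_le_mul_of_nonneg_left (h j l) (by positivity)
  have e3 : ∑ j, ∑ l, |s j| * |s l| * (n * (1 / K : ℝ)) = (∑ j, |s j|) ^ 2 * (n * (1 / K)) := by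
    simp_rw [← Finset.sum_mul]
    rw [sq, Finset.sum_mul_sum]
  have e4 : (∑ j, |s j|) ^ 2 ≤ K * ∑ j, s j ^ 2 := by
    simpa using sq_sum_le_card_mul_sum_sq (s := Finset.univ) (f := fun j => |s j|)
  have e5 : (∑ j, |s j|) ^ 2 * (n * (1 / K : ℝ)) ≤ n * ∑ j, s j ^ 2 := by
    calc (∑ j, |s j|) ^ 2 * (n * (1 / K : ℝ)) ≤ (K * ∑ j, s j ^ 2) * (n * (1 / K)) := by gcongr
      _ = n * ∑ j, s j ^ 2 := by field_simp
  simp only [Finset.sum_const, Finset.card_range, nsmul_eq_mul]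
  linarith

/-- With high probability the score vector `∑_{i < n} u(X_i)` has squared norm at least `n K / 2`,
while the empirical second moment matrix of `u` is at most twice the identity. -/
lemma measureReal_not_good_le (hX : ∀ i, Measurable (X i)) (hind : iIndepFun X P)
    (hlaw : ∀ i, P.map (X i) = ν) (hu : ∀ j, Measurable (u j)) {B : ℝ}
    (hB : ∀ j x, |u j x| ≤ B) (h0 : ∀ j, ∫ x, u j x ∂ν = 0)
    (hon : ∀ j l, ∫ x, u j x * u l x ∂ν = if j = l then 1 else 0) (hK : 4 ≤ K) {n : ℕ}
    (hn : 0 < n) :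
    P.real {ω | ¬ ((n * K / 2 : ℝ) ≤ ∑ j, (∑ i ∈ Finset.range n, u j (X i ω)) ^ 2 ∧
      ∀ s : Fin K → ℝ, ∑ i ∈ Finset.range n, (∑ j, s j * u j (X i ω)) ^ 2
        ≤ 2 * n * ∑ j, s j ^ 2)}
    ≤ 32 / K + K * (K * ((B ^ 2 + 1) ^ 2 / (1 / K : ℝ) ^ 2)) / n := by
  have : IsProbabilityMeasure ν := hlaw 0 ▸ Measure.isProbabilityMeasure_map (hX 0).aemeasurable
  have hn' : (0 : ℝ) < n := by exact_mod_cast hn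
  have hK0 : 0 < K := by omega
  have hK' : (4 : ℝ) ≤ K := by exact_mod_cast hK
  let w : Fin K → Fin K → E → ℝ := fun j l x => u j x * u l x - if j = l then 1 else 0
  let A : Fin K → Fin K → Set Ω := fun j l =>
    {ω | n * (1 / K : ℝ) ≤ |∑ i ∈ Finset.range n, w j l (X i ω)|}
  have hA : ∀ j l, P.real (A j l) ≤ (B ^ 2 + 1) ^ 2 / (1 / K : ℝ) ^ 2 / n := by
    intro j l
    have hb : ∀ x, |u j x * u l x| ≤ B ^ 2 := fun x => by
      rw [abs_mul, sq]
      exact mul_le_mul (hB j x) (hB l x) (abs_nonneg _) ((abs_nonneg _).trans (hB j x))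
    refine measureReal_le_abs_sum_range hX hind hlaw (((hu j).mul (hu l)).sub_const _)
      (fun x => (abs_sub _ _).trans (add_le_add (hb x) ?_)) ?_ hn (by positivity)
    · split_ifs <;> simp
    · rw [integral_sub (integrable_of_measurable_of_bound ((hu j).mul (hu l)) hb)
        (integrable_const _)]
      simp only [Pi.mul_apply]
      rw [hon]; simp
  have hsub : {ω | ¬ ((n * K / 2 : ℝ) ≤ ∑ j, (∑ i ∈ Finset.range n, u j (X i ω)) ^ 2 ∧
      ∀ s : Fin K → ℝ, ∑ i ∈ Finset.range n, (∑ j, s j * u j (X i ω)) ^ 2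
        ≤ 2 * n * ∑ j, s j ^ 2)}
      ⊆ {ω | offDiag X u n ω ≤ -(n * K / 4)} ∪ ⋃ j, ⋃ l, A j l := by
    intro ω hω
    by_contra hcon
    simp only [Set.mem_union, Set.mem_iUnion, not_or, not_exists, A, Set.mem_ofPred_eq,
      not_le] at hcon
    obtain ⟨hV, hQ⟩ := hcon
    refine hω ⟨?_, sum_sq_le_of_gram_close (y := fun i j => u j (X i ω))
      (fun j l => (hQ j l).le) hK0⟩
    have h1 : ∀ j, (n : ℝ) - n * (1 / K) ≤ ∑ i ∈ Finset.range n, u j (X i ω) ^ 2 := by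
      intro j
      have := (abs_lt.1 (hQ j j)).1
      simp only [w, if_true, Finset.sum_sub_distrib, Finset.sum_const, Finset.card_range,
        nsmul_eq_mul, mul_one, ← sq] at this
      linarith
    have h2 := Finset.sum_le_sum fun j (_ : j ∈ Finset.univ) => h1 j
    simp only [Finset.sum_const, Finset.card_univ, Fintype.card_fin, nsmul_eq_mul] at h2
    have h3 : (K : ℝ) * (n - n * (1 / K)) = n * K - n := by field_simp
    rw [offDiag, Finset.sum_sub_distrib] at hV
    nlinarith
  have hU : P.real (⋃ j, ⋃ l, A j l) ≤ K * (K * ((B ^ 2 + 1) ^ 2 / (1 / K : ℝ) ^ 2)) / n := by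
    calc P.real (⋃ j, ⋃ l, A j l) ≤ ∑ j, ∑ l, P.real (A j l) :=
          (measureReal_iUnion_fintype_le _).trans
            (Finset.sum_le_sum fun j _ => measureReal_iUnion_fintype_le _)
      _ ≤ ∑ _j : Fin K, ∑ _l : Fin K, (B ^ 2 + 1) ^ 2 / (1 / K : ℝ) ^ 2 / n :=
          Finset.sum_le_sum fun j _ => Finset.sum_le_sum fun l _ => hA j l
      _ = _ := by simp; ring
  calc _ ≤ P.real ({ω | offDiag X u n ω ≤ -(n * K / 4)} ∪ ⋃ j, ⋃ l, A j l) :=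
        measureReal_mono hsub
    _ ≤ _ := (measureReal_union_le _ _).trans
        (add_le_add (measureReal_offDiag_le hX hind hlaw hu hB h0 hon hK0 hn) hU)

end Moments

/-! ### The likelihood ratio along the best direction -/

lemma sub_two_mul_sq_le_log {x : ℝ} (hx : |x| ≤ 1 / 2) : x - 2 * x ^ 2 ≤ Real.log (1 + x) := by
  have h := Real.abs_log_sub_add_sum_range_le (x := -x) (by rw [abs_neg]; linarith) 1
  simp only [Finset.sum_range_one, abs_neg, sub_neg_eq_add] at h
  norm_num at h
  have h2 : x ^ 2 / (1 - |x|) ≤ 2 * x ^ 2 := by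
    rw [div_le_iff₀ (by linarith)]
    nlinarith [sq_nonneg x]
  have := (abs_le.1 h).1
  linarith

/-- Choosing `s` as the multiple of length `r / √n` of the score vector `∑_{i < n} y i` makes the
log-likelihood ratio of order `r ‖∑ y i‖ / √n`, with an error of order `r ^ 2`. -/
lemma exists_direction_log {K n : ℕ} (hn : 0 < n) (hK : 0 < K) {y : ℕ → Fin K → ℝ} {B r : ℝ}
    (hr : 0 < r) (hB : ∀ i j, |y i j| ≤ B) (hsmall : K * (r / √n * B) ≤ 1 / 2)
    (h1 : (n * K / 2 : ℝ) ≤ ∑ j, (∑ i ∈ Finset.range n, y i j) ^ 2)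
    (h2 : ∀ s : Fin K → ℝ, ∑ i ∈ Finset.range n, (∑ j, s j * y i j) ^ 2
        ≤ 2 * n * ∑ j, s j ^ 2) :
    ∃ s : Fin K → ℝ, (∀ j, |s j| ≤ r / √n) ∧ n * ∑ j, s j ^ 2 = r ^ 2 ∧
      (∀ i, |∑ j, s j * y i j| ≤ 1 / 2) ∧
      r * √(K / 2) - 4 * r ^ 2 ≤ ∑ i ∈ Finset.range n, Real.log (1 + ∑ j, s j * y i j) := by
  have hn' : (0 : ℝ) < n := by exact_mod_cast hn
  have hK' : (0 : ℝ) < K := by exact_mod_cast hK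
  have hsn : 0 < √(n : ℝ) := Real.sqrt_pos.2 hn'
  have hB0 : 0 ≤ B := (abs_nonneg _).trans (hB 0 ⟨0, hK⟩)
  set S : Fin K → ℝ := fun j => ∑ i ∈ Finset.range n, y i j with hS
  have hN : 0 < ∑ j, S j ^ 2 := lt_of_lt_of_le (by positivity) h1
  set N := √(∑ j, S j ^ 2) with hNdef
  have hN0 : 0 < N := Real.sqrt_pos.2 hN
  have hN2 : N ^ 2 = ∑ j, S j ^ 2 := Real.sq_sqrt hN.le
  have hSN : ∀ j, |S j| ≤ N := fun j => by
    refine Real.abs_le_sqrt ?_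
    exact Finset.single_le_sum (f := fun j => S j ^ 2) (fun j _ => sq_nonneg _) (Finset.mem_univ j)
  have hs : ∀ j, |r / √n * (S j / N)| ≤ r / √n := fun j => by
    rw [abs_mul, abs_div (S j), abs_of_pos hN0, abs_of_pos (div_pos hr hsn)]
    exact mul_le_of_le_one_right (by positivity) ((div_le_one hN0).2 (hSN j))
  have hnorm : n * ∑ j, (r / √n * (S j / N)) ^ 2 = r ^ 2 := by
    simp_rw [mul_pow, div_pow]
    rw [← Finset.mul_sum, ← Finset.sum_div, ← hN2, Real.sq_sqrt hn'.le]
    field_simp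
  have hx : ∀ i, |∑ j, r / √n * (S j / N) * y i j| ≤ 1 / 2 := fun i => by
    refine (Finset.abs_sum_le_sum_abs _ _).trans (le_trans ?_ hsmall)
    calc ∑ j, |r / √n * (S j / N) * y i j| ≤ ∑ _j : Fin K, r / √n * B :=
          Finset.sum_le_sum fun j _ => by
            rw [abs_mul]; exact mul_le_mul (hs j) (hB i j) (abs_nonneg _) (by positivity)
      _ = _ := by simp
  refine ⟨fun j => r / √n * (S j / N), hs, hnorm, hx, ?_⟩
  have hlog := Finset.sum_le_sum fun i (_ : i ∈ Finset.range n) => sub_two_mul_sq_le_log (hx i)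
  refine le_trans ?_ hlog
  rw [Finset.sum_sub_distrib, ← Finset.mul_sum]
  have hq := h2 fun j => r / √n * (S j / N)
  rw [mul_assoc, hnorm] at hq
  have hlin : ∑ i ∈ Finset.range n, ∑ j, r / √n * (S j / N) * y i j = r / √n * N := by
    rw [Finset.sum_comm]
    simp_rw [← Finset.mul_sum]
    have : ∀ j, r / √n * (S j / N) * ∑ i ∈ Finset.range n, y i j = r / √n / N * S j ^ 2 :=
      fun j => by simp only [hS]; ring
    simp_rw [this]
    rw [← Finset.mul_sum, ← hN2]
    field_simp
  rw [hlin]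
  have hNK : √(K / 2) * √n ≤ N := by
    rw [← Real.sqrt_mul (by positivity)]
    refine Real.sqrt_le_sqrt (le_trans (le_of_eq (by ring)) h1)
  have : r * √(K / 2) ≤ r / √n * N := by
    rw [div_mul_eq_mul_div, le_div_iff₀ hsn, mul_assoc]
    exact mul_le_mul_of_nonneg_left hNK hr.le
  linarith

/-! ### Bounded tilts of the mixing distribution and their scores -/

section Score

variable {T E : Type*} [MeasurableSpace T] [MeasurableSpace E] {p : T → E → ℝ≥0}
  {g₀ : ProbabilityMeasure T} {μ : Measure E}

/-- The score `E[φ(θ) | X = x]` of the direction `φ`: the relative change of `f_{g₀}(x)` when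
`g₀` is replaced by the measure with density `1 + φ` with respect to `g₀`. Division by zero makes
it vanish where `f_{g₀}(x)` is `0` or `∞`, so that the bounds below hold at every `x`. -/
def score (p : T → E → ℝ≥0) (g₀ : ProbabilityMeasure T) (φ : T → ℝ) (x : E) : ℝ :=
  (∫ θ, (p θ x : ℝ) * φ θ ∂(g₀ : Measure T)) / (mixDensity p g₀ x).toReal

lemma measurable_mixDensity (hp : Measurable (Function.uncurry p)) (g : ProbabilityMeasure T) :
    Measurable (mixDensity p g) :=
  Measurable.lintegral_prod_left' (f := fun z : T × E => (p z.1 z.2 : ℝ≥0∞)) hp.coe_nnreal_ennreal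

lemma measurable_score (hp : Measurable (Function.uncurry p)) {φ : T → ℝ} (hφ : Measurable φ) :
    Measurable (score p g₀ φ) := by
  refine Measurable.div ?_ (measurable_mixDensity hp g₀).ennreal_toReal
  have : StronglyMeasurable fun z : T × E => (p z.1 z.2 : ℝ) * φ z.1 :=
    (hp.coe_nnreal_real.mul (hφ.comp measurable_fst)).stronglyMeasurable
  exact this.integral_prod_left'.measurable

lemma measurable_section (hp : Measurable (Function.uncurry p)) (x : E) :
    Measurable fun θ => p θ x :=
  hp.comp (measurable_id.prodMk measurable_const)

lemma integrable_section (hp : Measurable (Function.uncurry p)) {x : E}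
    (hx : mixDensity p g₀ x ≠ ∞) : Integrable (fun θ => (p θ x : ℝ)) (g₀ : Measure T) := by
  refine ⟨(measurable_section hp x).coe_nnreal_real.aestronglyMeasurable, ?_⟩
  rw [hasFiniteIntegral_iff_enorm]
  simpa [mixDensity, lt_top_iff_ne_top] using hx

lemma integral_section (hp : Measurable (Function.uncurry p)) (x : E) :
    ∫ θ, (p θ x : ℝ) ∂(g₀ : Measure T) = (mixDensity p g₀ x).toReal := by
  rw [integral_eq_lintegral_of_nonneg_ae (Eventually.of_forall fun θ => NNReal.coe_nonneg (p θ x))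
    (measurable_section hp x).coe_nnreal_real.aestronglyMeasurable]
  simp [mixDensity]

lemma integrable_section_mul (hp : Measurable (Function.uncurry p)) {x : E}
    (hx : mixDensity p g₀ x ≠ ∞) {φ : T → ℝ} (hφ : Measurable φ) {C : ℝ}
    (hC : ∀ θ, |φ θ| ≤ C) : Integrable (fun θ => (p θ x : ℝ) * φ θ) (g₀ : Measure T) :=
  (integrable_section hp hx).mul_bdd (c := C) hφ.aestronglyMeasurable
    (Eventually.of_forall hC)

lemma abs_score_le (hp : Measurable (Function.uncurry p)) {φ : T → ℝ} {C : ℝ} (hC0 : 0 ≤ C)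
    (hC : ∀ θ, |φ θ| ≤ C) (x : E) : |score p g₀ φ x| ≤ C := by
  by_cases hx : mixDensity p g₀ x = ∞
  · simpa [score, hx] using hC0
  rw [score, abs_div, abs_of_nonneg (ENNReal.toReal_nonneg (a := mixDensity p g₀ x))]
  refine div_le_of_le_mul₀ ENNReal.toReal_nonneg hC0 ?_
  rw [← integral_section hp, ← integral_const_mul]
  refine (abs_integral_le_integral_abs).trans (integral_mono_of_nonneg
    (Eventually.of_forall fun θ => abs_nonneg _) ((integrable_section hp hx).const_mul C)
    (Eventually.of_forall fun θ => ?_))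
  simp only [abs_mul, NNReal.abs_eq]
  rw [mul_comm]
  exact mul_le_mul_of_nonneg_right (hC θ) (p θ x).2

lemma score_sum (hp : Measurable (Function.uncurry p)) {K : ℕ} {φ : Fin K → T → ℝ}
    (hφ : ∀ j, Measurable (φ j)) {C : ℝ} (hC : ∀ j θ, |φ j θ| ≤ C) (s : Fin K → ℝ) (x : E) :
    score p g₀ (fun θ => ∑ j, s j * φ j θ) x = ∑ j, s j * score p g₀ (φ j) x := by
  by_cases hx : mixDensity p g₀ x = ∞
  · simp [score, hx]
  simp only [score]
  have h1 : ∀ θ, (p θ x : ℝ) * ∑ j, s j * φ j θ = ∑ j, s j * ((p θ x : ℝ) * φ j θ) := fun θ => by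
    rw [Finset.mul_sum]; exact Finset.sum_congr rfl fun j _ => by ring
  simp_rw [h1]
  rw [integral_finsetSum _ fun j _ => (integrable_section_mul hp hx (hφ j) (hC j)).const_mul _,
    Finset.sum_div]
  exact Finset.sum_congr rfl fun j _ => by rw [integral_const_mul, mul_div_assoc]

lemma lintegral_mixDensity [SigmaFinite μ] (hp : Measurable (Function.uncurry p))
    (hd : ∀ θ, ∫⁻ x, (p θ x : ℝ≥0∞) ∂μ = 1) (g : ProbabilityMeasure T) :
    ∫⁻ x, mixDensity p g x ∂μ = 1 := by
  simp only [mixDensity]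
  rw [lintegral_lintegral_swap
    (f := fun x θ => (p θ x : ℝ≥0∞)) (hp.comp measurable_swap).coe_nnreal_ennreal.aemeasurable]
  simp [hd]

lemma ae_mixDensity_ne_top [SigmaFinite μ] (hp : Measurable (Function.uncurry p))
    (hd : ∀ θ, ∫⁻ x, (p θ x : ℝ≥0∞) ∂μ = 1) (g : ProbabilityMeasure T) :
    ∀ᵐ x ∂μ, mixDensity p g x < ∞ :=
  ae_lt_top (measurable_mixDensity hp g) (by rw [lintegral_mixDensity hp hd]; simp)

lemma ae_mixDensity_ne_zero_ne_top [SigmaFinite μ] (hp : Measurable (Function.uncurry p))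
    (hd : ∀ θ, ∫⁻ x, (p θ x : ℝ≥0∞) ∂μ = 1) (g : ProbabilityMeasure T) :
    ∀ᵐ x ∂(μ.withDensity (mixDensity p g)), mixDensity p g x ≠ 0 ∧ mixDensity p g x ≠ ∞ := by
  rw [ae_withDensity_iff (measurable_mixDensity hp g)]
  filter_upwards [ae_mixDensity_ne_top hp hd g] with x hx h0
  exact ⟨h0, hx.ne⟩

/-- The score is centred if the direction is: `E[E[φ(θ) | X]] = E[φ(θ)]`. -/
lemma integral_score [SigmaFinite μ] (hp : Measurable (Function.uncurry p))
    (hd : ∀ θ, ∫⁻ x, (p θ x : ℝ≥0∞) ∂μ = 1) {φ : T → ℝ} (hφ : Measurable φ) {C : ℝ}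
    (hC : ∀ θ, |φ θ| ≤ C) :
    ∫ x, score p g₀ φ x ∂(μ.withDensity (mixDensity p g₀)) = ∫ θ, φ θ ∂(g₀ : Measure T) := by
  rw [integral_withDensity_eq_integral_toReal_smul (measurable_mixDensity hp g₀)
    (ae_mixDensity_ne_top hp hd g₀)]
  have h1 : ∀ᵐ x ∂μ, (mixDensity p g₀ x).toReal • score p g₀ φ x
      = ∫ θ, (p θ x : ℝ) * φ θ ∂(g₀ : Measure T) := by
    filter_upwards [ae_mixDensity_ne_top hp hd g₀] with x hx
    rw [score, smul_eq_mul]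
    by_cases h0 : mixDensity p g₀ x = 0
    · have : (fun θ => (p θ x : ℝ≥0∞)) =ᵐ[(g₀ : Measure T)] 0 :=
        (lintegral_eq_zero_iff (measurable_section hp x).coe_nnreal_ennreal).1 h0
      rw [h0, integral_eq_zero_of_ae]
      · simp
      · filter_upwards [this] with θ hθ
        have : p θ x = 0 := by simpa using hθ
        simp [this]
    · rw [mul_div_cancel₀ _ (ENNReal.toReal_ne_zero.2 ⟨h0, hx.ne⟩)]
  rw [integral_congr_ae h1]
  have hint : Integrable (Function.uncurry fun x θ => (p θ x : ℝ) * φ θ)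
      (μ.prod (g₀ : Measure T)) := by
    have h2 : Integrable (fun z : E × T => (p z.2 z.1 : ℝ)) (μ.prod (g₀ : Measure T)) := by
      refine ⟨(hp.comp measurable_swap).coe_nnreal_real.aestronglyMeasurable, ?_⟩
      rw [hasFiniteIntegral_iff_enorm]
      have h3 := lintegral_prod (μ := μ) (ν := (g₀ : Measure T))
        (fun z : E × T => (p z.2 z.1 : ℝ≥0∞))
        (hp.comp measurable_swap).coe_nnreal_ennreal.aemeasurable
      have h4 := lintegral_mixDensity hp hd g₀
      simp only [mixDensity] at h4
      rw [h4] at h3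
      simp [h3]
    exact h2.mul_bdd (c := C) (hφ.comp measurable_snd).aestronglyMeasurable
      (Eventually.of_forall fun z => hC z.2)
  rw [integral_integral_swap hint]
  refine integral_congr_ae (Eventually.of_forall fun θ => ?_)
  simp only
  rw [integral_mul_const, integral_eq_lintegral_of_nonneg_ae
    (Eventually.of_forall fun x => NNReal.coe_nonneg (p θ x))
    (hp.comp (measurable_const.prodMk measurable_id)).coe_nnreal_real.aestronglyMeasurable]
  simp [hd]

/-- The probability measure with density `1 + φ` with respect to `g₀`. -/
def tilt (g₀ : ProbabilityMeasure T) (φ : T → ℝ) (hφ : Measurable φ) (h1 : ∀ θ, |φ θ| ≤ 1)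
    (h0 : ∫ θ, φ θ ∂(g₀ : Measure T) = 0) : ProbabilityMeasure T :=
  ⟨(g₀ : Measure T).withDensity fun θ => ENNReal.ofReal (1 + φ θ), by
    constructor
    have hi : Integrable φ (g₀ : Measure T) :=
      Integrable.of_bound hφ.aestronglyMeasurable 1 (Eventually.of_forall h1)
    rw [withDensity_apply _ MeasurableSet.univ, setLIntegral_univ,
      ← ofReal_integral_eq_lintegral_ofReal (f := fun θ => 1 + φ θ)
        ((integrable_const 1).add hi)
        (Eventually.of_forall fun θ => by
          have := (abs_le.1 (h1 θ)).1
          simp only [Pi.zero_apply]; linarith)]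
    rw [integral_add (integrable_const 1) hi, h0]
    simp⟩

variable {φ : T → ℝ} {hφ : Measurable φ} {h1 : ∀ θ, |φ θ| ≤ 1}
  {h0 : ∫ θ, φ θ ∂(g₀ : Measure T) = 0}

lemma mixDensity_tilt (hp : Measurable (Function.uncurry p)) {x : E}
    (hx0 : mixDensity p g₀ x ≠ 0) (hx : mixDensity p g₀ x ≠ ∞) :
    mixDensity p (tilt g₀ φ hφ h1 h0) x
      = mixDensity p g₀ x * ENNReal.ofReal (1 + score p g₀ φ x) := by
  have hpos : 0 < (mixDensity p g₀ x).toReal := ENNReal.toReal_pos hx0 hx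
  have hi := integrable_section_mul hp hx hφ h1
  have hm : Measurable fun θ => ENNReal.ofReal (1 + φ θ) := (hφ.const_add 1).ennreal_ofReal
  have e1 : mixDensity p (tilt g₀ φ hφ h1 h0) x
      = ∫⁻ θ, ENNReal.ofReal ((p θ x : ℝ) + (p θ x : ℝ) * φ θ) ∂(g₀ : Measure T) := by
    rw [mixDensity]
    simp only [tilt, ProbabilityMeasure.coe_mk]
    rw [lintegral_withDensity_eq_lintegral_mul _ hm
      (measurable_section hp x).coe_nnreal_ennreal]
    refine lintegral_congr fun θ => ?_
    have := (abs_le.1 (h1 θ)).1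
    rw [Pi.mul_apply, ← ENNReal.ofReal_coe_nnreal, ← ENNReal.ofReal_mul (by linarith)]
    congr 1; ring
  have hnn : ∀ θ, 0 ≤ (p θ x : ℝ) + (p θ x : ℝ) * φ θ := fun θ => by
    have := (abs_le.1 (h1 θ)).1
    nlinarith [(p θ x).2]
  rw [e1, ← ofReal_integral_eq_lintegral_ofReal
    (f := fun θ => (p θ x : ℝ) + (p θ x : ℝ) * φ θ) ((integrable_section hp hx).add hi)
    (Eventually.of_forall hnn)]
  rw [integral_add (integrable_section hp hx) hi, integral_section hp,
    ← ENNReal.ofReal_toReal hx, ← ENNReal.ofReal_mul hpos.le, score, ENNReal.ofReal_toReal hx]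
  congr 1
  field_simp

lemma chiSq_tilt [SigmaFinite μ] (hp : Measurable (Function.uncurry p))
    (hd : ∀ θ, ∫⁻ x, (p θ x : ℝ≥0∞) ∂μ = 1) :
    chiSq μ (mixDensity p (tilt g₀ φ hφ h1 h0)) (mixDensity p g₀)
      = ENNReal.ofReal (∫ x, score p g₀ φ x ^ 2 ∂(μ.withDensity (mixDensity p g₀))) := by
  have : IsProbabilityMeasure (μ.withDensity (mixDensity p g₀)) :=
    ⟨by rw [withDensity_apply _ MeasurableSet.univ, setLIntegral_univ, lintegral_mixDensity hp hd]⟩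
  have hb : ∀ x, |score p g₀ φ x| ≤ 1 := abs_score_le hp zero_le_one h1
  have e : (fun x => (mixDensity p (tilt g₀ φ hφ h1 h0) x / mixDensity p g₀ x).toReal - 1)
      =ᵐ[μ.withDensity (mixDensity p g₀)] score p g₀ φ := by
    filter_upwards [ae_mixDensity_ne_zero_ne_top hp hd g₀] with x hx
    have := (abs_le.1 (hb x)).1
    rw [mixDensity_tilt hp hx.1 hx.2, mul_comm, ENNReal.mul_div_cancel_right hx.1 hx.2,
      ENNReal.toReal_ofReal (by linarith)]
    ring
  have h2 := eLpNorm_nnreal_pow_eq_lintegral (μ := μ.withDensity (mixDensity p g₀))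
    (f := score p g₀ φ) (p := 2) two_ne_zero
  simp only [ENNReal.coe_ofNat, NNReal.coe_ofNat, ENNReal.rpow_ofNat] at h2
  rw [chiSq, eLpNorm_congr_ae e, h2, ofReal_integral_eq_lintegral_ofReal]
  · refine lintegral_congr fun x => ?_
    rw [← sq_abs, ENNReal.ofReal_pow (abs_nonneg _), Real.enorm_eq_ofReal_abs]
  · exact Integrable.of_bound ((measurable_score hp hφ).pow_const 2).aestronglyMeasurable 1
      (Eventually.of_forall fun x => by
        rw [norm_pow]; exact pow_le_one₀ (norm_nonneg _) (hb x))
  · exact Eventually.of_forall fun x => sq_nonneg _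

/-- If `g₀` is identifiable, a centred direction with vanishing score vanishes. -/
lemma ae_eq_zero_of_score_ae_eq_zero [SigmaFinite μ] (hp : Measurable (Function.uncurry p))
    (hd : ∀ θ, ∫⁻ x, (p θ x : ℝ≥0∞) ∂μ = 1)
    (hID : ∀ g : ProbabilityMeasure T,
      chiSq μ (mixDensity p g) (mixDensity p g₀) = 0 → g = g₀)
    {φ : T → ℝ} (hφ : Measurable φ) {C : ℝ} (hC : ∀ θ, |φ θ| ≤ C)
    (h0 : ∫ θ, φ θ ∂(g₀ : Measure T) = 0)
    (hs : score p g₀ φ =ᵐ[μ.withDensity (mixDensity p g₀)] 0) :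
    φ =ᵐ[(g₀ : Measure T)] 0 := by
  -- The direction is rescaled to be bounded by one, so that it defines a tilt.
  set D := |C| + 1 with hD
  have hD0 : 0 < D := by positivity
  set ψ : T → ℝ := fun θ => D⁻¹ * φ θ with hψ
  have hψm : Measurable ψ := hφ.const_mul _
  have hψ1 : ∀ θ, |ψ θ| ≤ 1 := fun θ => by
    rw [hψ, abs_mul, abs_of_pos (inv_pos.2 hD0), inv_mul_le_iff₀ hD0, mul_one]
    exact (hC θ).trans ((le_abs_self C).trans (by linarith))
  have hψ0 : ∫ θ, ψ θ ∂(g₀ : Measure T) = 0 := by rw [hψ, integral_const_mul, h0, mul_zero]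
  have hsψ : ∀ x, score p g₀ ψ x = D⁻¹ * score p g₀ φ x := fun x => by
    simp only [score, hψ]
    simp_rw [mul_left_comm _ (D⁻¹)]
    rw [integral_const_mul, mul_div_assoc]
  have hchi : chiSq μ (mixDensity p (tilt g₀ ψ hψm hψ1 hψ0)) (mixDensity p g₀) = 0 := by
    rw [chiSq_tilt hp hd, integral_eq_zero_of_ae, ENNReal.ofReal_zero]
    filter_upwards [hs] with x hx
    simp [hsψ, hx]
  have hg := congrArg (fun g : ProbabilityMeasure T => (g : Measure T)) (hID _ hchi)
  simp only [tilt, ProbabilityMeasure.coe_mk] at hg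
  have hone : (g₀ : Measure T).withDensity (fun θ => ENNReal.ofReal (1 + ψ θ))
      = (g₀ : Measure T).withDensity 1 := by rw [hg, withDensity_one]
  have hae := (withDensity_eq_iff_of_sigmaFinite
    (hψm.const_add 1).ennreal_ofReal.aemeasurable (g := 1) aemeasurable_one).1 hone
  filter_upwards [hae] with θ hθ
  have h3 := (abs_le.1 (hψ1 θ)).1
  have h4 : 1 + ψ θ = 1 := by
    have := congrArg ENNReal.toReal hθ
    rwa [ENNReal.toReal_ofReal (by linarith), Pi.one_apply, ENNReal.toReal_one] at this
  have h5 : D⁻¹ * φ θ = 0 := by linarith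
  simpa [hD0.ne'] using h5

lemma log_mixDensity_tilt (hp : Measurable (Function.uncurry p)) {x : E}
    (hx0 : mixDensity p g₀ x ≠ 0) (hx : mixDensity p g₀ x ≠ ∞) (hs : 0 < 1 + score p g₀ φ x) :
    ENNReal.log (mixDensity p (tilt g₀ φ hφ h1 h0) x)
      = ((Real.log (mixDensity p g₀ x).toReal + Real.log (1 + score p g₀ φ x) : ℝ) : EReal) := by
  rw [mixDensity_tilt hp hx0 hx, ENNReal.log_mul_add, ENNReal.log_pos_real hx0 hx,
    ENNReal.log_ofReal_of_pos hs, EReal.coe_add]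

end Score

/-! ### Orthonormal systems of bounded scores -/

lemma exists_disjoint_pos {T : Type*} [TopologicalSpace T] [SecondCountableTopology T] [T2Space T]
    [MeasurableSpace T] [OpensMeasurableSpace T] {g : ProbabilityMeasure T}
    (hg : ¬ FinitelyDiscrete g) (N : ℕ) :
    ∃ A : Fin N → Set T, (∀ i, MeasurableSet (A i)) ∧ Pairwise (Function.onFun Disjoint A) ∧
      ∀ i, 0 < (g : Measure T) (A i) := by
  have hinf : (g : Measure T).support.Infinite := fun hfin =>
    hg ⟨_, hfin, Measure.measure_compl_support⟩
  obtain ⟨t, ht, rfl⟩ := hinf.exists_subset_card_eq N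
  obtain ⟨U, hU, hdis⟩ := t.finite_toSet.t2_separation
  let e := t.equivFin.symm
  refine ⟨fun i => U (e i), fun i => (hU _).2.measurableSet, fun i j hij => ?_, fun i => ?_⟩
  · exact hdis (e i).2 (e j).2 fun h => hij (e.injective (Subtype.ext h))
  · exact (Measure.mem_support_iff_forall _).1 (ht (e i).2) _ ((hU _).2.mem_nhds (hU _).1)

/-- A mixing distribution with infinite support has arbitrarily many bounded centred directions
that are linearly independent modulo null sets. -/
lemma exists_independent_directions {T : Type*} [TopologicalSpace T] [SecondCountableTopology T]
    [T2Space T] [MeasurableSpace T] [OpensMeasurableSpace T] {g : ProbabilityMeasure T}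
    (hg : ¬ FinitelyDiscrete g) (K : ℕ) :
    ∃ (ψ : Fin K → T → ℝ) (C : ℝ), (∀ j, Measurable (ψ j)) ∧ (∀ j θ, |ψ j θ| ≤ C) ∧
      (∀ j, ∫ θ, ψ j θ ∂(g : Measure T) = 0) ∧
      ∀ c : Fin K → ℝ, (fun θ => ∑ j, c j * ψ j θ) =ᵐ[(g : Measure T)] 0 → c = 0 := by
  obtain ⟨A, hAm, hAd, hA⟩ := exists_disjoint_pos hg (K + 1)
  set w : Fin (K + 1) → ℝ := fun i => ((g : Measure T) (A i)).toReal with hw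
  have hwpos : ∀ i, 0 < w i := fun i => ENNReal.toReal_pos (hA i).ne' (measure_ne_top _ _)
  let ψ : Fin K → T → ℝ := fun j θ =>
    (A j.succ).indicator (fun _ => (w j.succ)⁻¹) θ - (A 0).indicator (fun _ => (w 0)⁻¹) θ
  have hind : ∀ i, Measurable ((A i).indicator fun _ => (w i)⁻¹) := fun i =>
    measurable_const.indicator (hAm i)
  have hle : ∀ i θ, |(A i).indicator (fun _ => (w i)⁻¹) θ| ≤ ∑ i, (w i)⁻¹ := fun i θ => by
    have h1 : (w i)⁻¹ ≤ ∑ i, (w i)⁻¹ := Finset.single_le_sum (f := fun i => (w i)⁻¹)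
      (fun i _ => (inv_pos.2 (hwpos i)).le) (Finset.mem_univ i)
    by_cases h : θ ∈ A i
    · rwa [Set.indicator_of_mem h, abs_of_pos (inv_pos.2 (hwpos i))]
    · rw [Set.indicator_of_notMem h, abs_zero]
      exact (inv_pos.2 (hwpos i)).le.trans h1
  have hint : ∀ i, ∫ θ, (A i).indicator (fun _ => (w i)⁻¹) θ ∂(g : Measure T) = 1 := fun i => by
    rw [integral_indicator_const _ (hAm i), smul_eq_mul, measureReal_def]
    exact mul_inv_cancel₀ (hwpos i).ne'
  have hi : ∀ i, Integrable ((A i).indicator fun _ => (w i)⁻¹) (g : Measure T) := fun i =>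
    (integrable_const _).indicator (hAm i)
  refine ⟨ψ, ∑ i, (w i)⁻¹ + ∑ i, (w i)⁻¹, fun j => (hind _).sub (hind _),
    fun j θ => (abs_sub _ _).trans (add_le_add (hle _ θ) (hle _ θ)), fun j => ?_,
    fun c hc => funext fun j => ?_⟩
  · rw [integral_sub (hi _) (hi _), hint, hint, sub_self]
  · obtain ⟨θ, hθ, hθj⟩ : ∃ θ, θ ∈ A j.succ ∧ ∑ l, c l * ψ l θ = 0 := by
      have h1 : ∃ᶠ θ in ae (g : Measure T), θ ∈ A j.succ :=
        frequently_ae_mem_iff.2 (hA j.succ).ne'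
      exact (h1.and_eventually hc).exists
    have h0 : ∀ i, i ≠ j.succ → θ ∉ A i := fun i hi h =>
      Set.disjoint_left.1 (hAd hi) h hθ
    rw [Finset.sum_eq_single j] at hθj
    · simp only [ψ, Set.indicator_of_mem hθ,
        Set.indicator_of_notMem (h0 0 (Fin.succ_ne_zero j).symm), sub_zero] at hθj
      simpa [(hwpos j.succ).ne'] using hθj
    · intro l _ hl
      simp [ψ, h0 0 (Fin.succ_ne_zero j).symm, h0 l.succ fun h => hl (Fin.succ_injective _ h)]
    · simp

/-- Identifiability makes the scores of independent directions linearly independent in `L²`, so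
that the Gram–Schmidt process yields orthonormal ones. -/
lemma exists_orthonormal_scores {T E : Type*} [TopologicalSpace T] [SecondCountableTopology T]
    [T2Space T] [MeasurableSpace T] [OpensMeasurableSpace T] [MeasurableSpace E]
    {p : T → E → ℝ≥0} {g₀ : ProbabilityMeasure T} {μ : Measure E} [SigmaFinite μ]
    (hp : Measurable (Function.uncurry p))
    (hd : ∀ θ, ∫⁻ x, (p θ x : ℝ≥0∞) ∂μ = 1)
    (hID : ∀ g : ProbabilityMeasure T,
      chiSq μ (mixDensity p g) (mixDensity p g₀) = 0 → g = g₀)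
    (hg : ¬ FinitelyDiscrete g₀) (K : ℕ) :
    ∃ (φ : Fin K → T → ℝ) (C : ℝ), 0 ≤ C ∧ (∀ j, Measurable (φ j)) ∧ (∀ j θ, |φ j θ| ≤ C) ∧
      (∀ j, ∫ θ, φ j θ ∂(g₀ : Measure T) = 0) ∧
      ∀ j l, ∫ x, score p g₀ (φ j) x * score p g₀ (φ l) x ∂(μ.withDensity (mixDensity p g₀))
        = if j = l then 1 else 0 := by
  set ν := μ.withDensity (mixDensity p g₀) with hν
  have : IsProbabilityMeasure ν :=
    ⟨by rw [withDensity_apply _ MeasurableSet.univ, setLIntegral_univ, lintegral_mixDensity hp hd]⟩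
  obtain ⟨ψ, C, hψm, hψC, hψ0, hψli⟩ := exists_independent_directions hg K
  have hint : ∀ j, Integrable (ψ j) (g₀ : Measure T) := fun j =>
    Integrable.of_bound (hψm j).aestronglyMeasurable C (Eventually.of_forall (hψC j))
  have hcomb : ∀ c : Fin K → ℝ, (Measurable fun θ => ∑ j, c j * ψ j θ) ∧
      (∀ θ, |∑ j, c j * ψ j θ| ≤ ∑ j, |c j| * |C|) ∧
      ∫ θ, ∑ j, c j * ψ j θ ∂(g₀ : Measure T) = 0 := by
    refine fun c => ⟨Finset.measurable_fun_sum _ fun j _ => (hψm j).const_mul _, fun θ => ?_, ?_⟩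
    · refine (Finset.abs_sum_le_sum_abs _ _).trans (Finset.sum_le_sum fun j _ => ?_)
      rw [abs_mul]
      exact mul_le_mul_of_nonneg_left ((hψC j θ).trans (le_abs_self C)) (abs_nonneg _)
    · rw [integral_finsetSum _ fun j _ => (hint j).const_mul _]
      simp [integral_const_mul, hψ0]
  have hmem : ∀ j, MemLp (score p g₀ (ψ j)) 2 ν := fun j =>
    MemLp.of_bound (measurable_score hp (hψm j)).aestronglyMeasurable |C|
      (Eventually.of_forall fun x =>
        abs_score_le hp (abs_nonneg C) (fun θ => (hψC j θ).trans (le_abs_self C)) x)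
  let v : Fin K → Lp ℝ 2 ν := fun j => (hmem j).toLp
  have hsum : ∀ c : Fin K → ℝ,
      (∑ j, c j • v j : Lp ℝ 2 ν) =ᵐ[ν] score p g₀ fun θ => ∑ j, c j * ψ j θ := by
    intro c
    have h1 : ∀ j, (c j • v j : Lp ℝ 2 ν) =ᵐ[ν] fun x => c j * score p g₀ (ψ j) x := fun j => by
      filter_upwards [Lp.coeFn_smul (c j) (v j), (hmem j).coeFn_toLp] with x h2 h3
      rw [h2, Pi.smul_apply, smul_eq_mul, h3]
    filter_upwards [Lp.coeFn_finsetSum Finset.univ fun j => c j • v j, ae_all_iff.2 h1] with x h2 h3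
    rw [h2, score_sum hp hψm hψC]
    simp [h3]
  have hli : LinearIndependent ℝ v := by
    refine Fintype.linearIndependent_iff.2 fun c hc => ?_
    have h1 : score p g₀ (fun θ => ∑ j, c j * ψ j θ) =ᵐ[ν] 0 := by
      have := hsum c
      rw [hc] at this
      exact this.symm.trans (Lp.coeFn_zero _ _ _)
    obtain ⟨hm, hb, h0⟩ := hcomb c
    exact congrFun (hψli c (ae_eq_zero_of_score_ae_eq_zero hp hd hID hm hb h0 h1))
  have hon := InnerProductSpace.gramSchmidtNormed_orthonormal (𝕜 := ℝ) hli
  have hspan : ∀ i, ∃ a : Fin K → ℝ,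
      ∑ j, a j • v j = InnerProductSpace.gramSchmidtNormed ℝ v i := by
    intro i
    rw [← Submodule.mem_span_range_iff_exists_fun, ← InnerProductSpace.span_gramSchmidt ℝ v,
      ← InnerProductSpace.span_gramSchmidtNormed_range]
    exact Submodule.subset_span ⟨i, rfl⟩
  choose a ha using hspan
  refine ⟨fun i θ => ∑ j, a i j * ψ j θ, ∑ i, ∑ j, |a i j| * |C|, by positivity,
    fun i => (hcomb (a i)).1, fun i θ => ((hcomb (a i)).2.1 θ).trans ?_,
    fun i => (hcomb (a i)).2.2, fun i l => ?_⟩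
  · exact Finset.single_le_sum (f := fun i => ∑ j, |a i j| * |C|) (fun i _ => by positivity)
      (Finset.mem_univ i)
  · rw [← orthonormal_iff_ite.1 hon i l, L2.inner_def]
    refine integral_congr_ae ?_
    filter_upwards [hsum (a i), hsum (a l)] with x h1 h2
    rw [← h1, ← h2, ha, ha]
    simp [mul_comm]

/-! ### Divergence of the likelihood ratio -/

lemma coe_sum_ereal {ι : Type*} (t : Finset ι) (f : ι → ℝ) :
    ((∑ i ∈ t, f i : ℝ) : EReal) = ∑ i ∈ t, (f i : EReal) := by
  classical
  induction t using Finset.induction_on with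
  | empty => simp
  | insert i t hi ih => rw [Finset.sum_insert hi, Finset.sum_insert hi, EReal.coe_add, ih]

lemma tendsto_const_mul_div_sqrt (a r b : ℝ) :
    Tendsto (fun n : ℕ => a * (r / √(n : ℝ) * b)) atTop (𝓝 0) := by
  have h : Tendsto (fun n : ℕ => r / √(n : ℝ)) atTop (𝓝 0) :=
    tendsto_const_nhds.div_atTop (Real.tendsto_sqrt_atTop.comp tendsto_natCast_atTop_atTop)
  simpa using (h.mul_const b).const_mul a

lemma integral_sq_sum_of_orthonormal {E : Type*} [MeasurableSpace E] {ν : Measure E}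
    [IsFiniteMeasure ν] {K : ℕ} {u : Fin K → E → ℝ} (hu : ∀ j, Measurable (u j)) {B : ℝ}
    (hB : ∀ j x, |u j x| ≤ B)
    (hon : ∀ j l, ∫ x, u j x * u l x ∂ν = if j = l then 1 else 0) (s : Fin K → ℝ) :
    ∫ x, (∑ j, s j * u j x) ^ 2 ∂ν = ∑ j, s j ^ 2 := by
  have hi : ∀ j l, Integrable (fun x => s j * s l * (u j x * u l x)) ν := fun j l =>
    (integrable_of_measurable_of_bound (C := B * B) ((hu j).mul (hu l)) fun x => by
      simp only [Pi.mul_apply, abs_mul]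
      exact mul_le_mul (hB j x) (hB l x) (abs_nonneg _)
        ((abs_nonneg _).trans (hB j x))).const_mul _
  have e : ∀ x, (∑ j, s j * u j x) ^ 2 = ∑ j, ∑ l, s j * s l * (u j x * u l x) := fun x => by
    rw [sq, Finset.sum_mul_sum]
    exact Finset.sum_congr rfl fun j _ => Finset.sum_congr rfl fun l _ => by ring
  simp_rw [e]
  rw [integral_finsetSum _ fun j _ => integrable_finsetSum _ fun l _ => hi j l]
  simp_rw [integral_finsetSum _ fun l _ => hi _ l, integral_const_mul, hon]
  simp [sq]

/-- With probability close to one, some mixing distribution at `χ²`-distance exactly `r ^ 2 / n`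
from `g₀` has a log-likelihood exceeding that of `g₀` by at least `c`. -/
lemma eventually_exists_large_logLik {T E Ω : Type*} [TopologicalSpace T]
    [SecondCountableTopology T] [T2Space T] [MeasurableSpace T] [OpensMeasurableSpace T]
    [MeasurableSpace E] [MeasurableSpace Ω]
    {p : T → E → ℝ≥0} {g₀ : ProbabilityMeasure T} {μ : Measure E} [SigmaFinite μ]
    (hp : Measurable (Function.uncurry p))
    (hd : ∀ θ, ∫⁻ x, (p θ x : ℝ≥0∞) ∂μ = 1)
    (hID : ∀ g : ProbabilityMeasure T,
      chiSq μ (mixDensity p g) (mixDensity p g₀) = 0 → g = g₀)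
    (hg : ¬ FinitelyDiscrete g₀) {P : Measure Ω} [IsProbabilityMeasure P] {X : ℕ → Ω → E}
    (hX : ∀ i, Measurable (X i)) (hind : iIndepFun X P)
    (hlaw : ∀ i, P.map (X i) = μ.withDensity (mixDensity p g₀))
    (c : ℝ) {r : ℝ} (hr : 0 < r) {ε : ℝ} (hε : 0 < ε) :
    ∀ᶠ n : ℕ in atTop, P {ω | ¬ ∃ (g : ProbabilityMeasure T) (a : ℝ),
      logLik (fun i => X i ω) n (mixDensity p g₀) = a ∧
      ((a + c : ℝ) : EReal) ≤ logLik (fun i => X i ω) n (mixDensity p g) ∧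
      (n : ℝ≥0∞) * chiSq μ (mixDensity p g) (mixDensity p g₀) = ENNReal.ofReal (r ^ 2)}
      ≤ ENNReal.ofReal ε := by
  set ν := μ.withDensity (mixDensity p g₀) with hν
  have : IsProbabilityMeasure ν :=
    ⟨by rw [withDensity_apply _ MeasurableSet.univ, setLIntegral_univ, lintegral_mixDensity hp hd]⟩
  -- The number of directions is chosen large in terms of `c`, `r` and `ε`.
  obtain ⟨K, hK4, hKε, hKc⟩ : ∃ K : ℕ, 4 ≤ K ∧ 32 / (K : ℝ) ≤ ε / 2 ∧
      c ≤ r * √((K : ℝ) / 2) - 4 * r ^ 2 := by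
    have h1 : Tendsto (fun K : ℕ => 32 / (K : ℝ)) atTop (𝓝 0) :=
      tendsto_const_div_atTop_nhds_zero_nat 32
    have h2 : Tendsto (fun K : ℕ => r * √((K : ℝ) / 2) - 4 * r ^ 2) atTop atTop :=
      tendsto_atTop_add_const_right _ _ (Tendsto.const_mul_atTop hr
        (Real.tendsto_sqrt_atTop.comp (tendsto_natCast_atTop_atTop.atTop_div_const two_pos)))
    exact ((eventually_ge_atTop 4).and ((h1.eventually_le_const (half_pos hε)).and
      (h2.eventually_ge_atTop c))).exists
  obtain ⟨φ, C, hC0, hφm, hφC, hφ0, hon⟩ := exists_orthonormal_scores hp hd hID hg K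
  have hum : ∀ j, Measurable (score p g₀ (φ j)) := fun j => measurable_score hp (hφm j)
  have huC : ∀ j x, |score p g₀ (φ j) x| ≤ C := fun j => abs_score_le hp hC0 (hφC j)
  have hu0 : ∀ j, ∫ x, score p g₀ (φ j) x ∂ν = 0 := fun j => by
    rw [integral_score hp hd (hφm j) (hφC j), hφ0]
  have hpos : ∀ᵐ ω ∂P, ∀ i, mixDensity p g₀ (X i ω) ≠ 0 ∧ mixDensity p g₀ (X i ω) ≠ ∞ := by
    refine ae_all_iff.2 fun i => ?_
    have h := ae_mixDensity_ne_zero_ne_top (μ := μ) hp hd g₀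
    rw [← hν, ← hlaw i] at h
    exact ae_of_ae_map (hX i).aemeasurable h
  filter_upwards [eventually_gt_atTop 0,
    (tendsto_const_mul_div_sqrt K r C).eventually_le_const (half_pos one_pos),
    (tendsto_const_div_atTop_nhds_zero_nat
      (K * (K * ((C ^ 2 + 1) ^ 2 / (1 / K : ℝ) ^ 2)))).eventually_le_const (half_pos hε)]
    with n hn hsmall hnε
  have hgood := measureReal_not_good_le hX hind hlaw hum huC hu0 hon hK4 hn
  refine le_trans (measure_mono_ae ?_)
    (ENNReal.le_ofReal_iff_toReal_le (measure_ne_top _ _) hε.le |>.2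
      (hgood.trans (by linarith)))
  filter_upwards [hpos] with ω hω hbad
  refine fun ⟨hS, hQ⟩ => hbad ?_
  obtain ⟨s, hs, hnorm, hhalf, hlog⟩ := exists_direction_log hn (by omega : 0 < K)
    (y := fun i j => score p g₀ (φ j) (X i ω)) hr (fun i j => huC j (X i ω)) hsmall hS hQ
  have hφs : Measurable fun θ => ∑ j, s j * φ j θ :=
    Finset.measurable_fun_sum _ fun j _ => (hφm j).const_mul _
  have hφs1 : ∀ θ, |∑ j, s j * φ j θ| ≤ 1 := fun θ => by
    refine (Finset.abs_sum_le_sum_abs _ _).trans (le_trans ?_ (hsmall.trans (by norm_num)))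
    calc ∑ j, |s j * φ j θ| ≤ ∑ _j : Fin K, r / √n * C :=
          Finset.sum_le_sum fun j _ => by
            rw [abs_mul]; exact mul_le_mul (hs j) (hφC j θ) (abs_nonneg _) (by positivity)
      _ = _ := by simp
  have hφs0 : ∫ θ, ∑ j, s j * φ j θ ∂(g₀ : Measure T) = 0 := by
    rw [integral_finsetSum _ fun j _ =>
      (integrable_of_measurable_of_bound (hφm j) (hφC j)).const_mul _]
    simp [integral_const_mul, hφ0]
  have hscore : ∀ x, score p g₀ (fun θ => ∑ j, s j * φ j θ) x
      = ∑ j, s j * score p g₀ (φ j) x := score_sum hp hφm hφC s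
  refine ⟨tilt g₀ _ hφs hφs1 hφs0,
    ∑ i ∈ Finset.range n, Real.log (mixDensity p g₀ (X i ω)).toReal, ?_, ?_, ?_⟩
  · rw [logLik, coe_sum_ereal]
    exact Finset.sum_congr rfl fun i _ => ENNReal.log_pos_real (hω i).1 (hω i).2
  · have e : logLik (fun i => X i ω) n (mixDensity p (tilt g₀ _ hφs hφs1 hφs0))
        = ((∑ i ∈ Finset.range n, (Real.log (mixDensity p g₀ (X i ω)).toReal
          + Real.log (1 + ∑ j, s j * score p g₀ (φ j) (X i ω))) : ℝ) : EReal) := by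
      rw [logLik, coe_sum_ereal]
      refine Finset.sum_congr rfl fun i _ => ?_
      rw [log_mixDensity_tilt hp (hω i).1 (hω i).2, hscore]
      rw [hscore]
      linarith [(abs_le.1 (hhalf i)).1]
    rw [e, EReal.coe_le_coe_iff, Finset.sum_add_distrib]
    linarith
  · rw [chiSq_tilt hp hd]
    simp_rw [hscore]
    rw [integral_sq_sum_of_orthonormal hum huC hon, ← hnorm, ENNReal.ofReal_mul (by positivity),
      ENNReal.ofReal_natCast]

end NPMLE

end

theorem theorem3 {d m : ℕ} (Θ : Set (EuclideanSpace ℝ (Fin d)))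
    (μ : Measure (EuclideanSpace ℝ (Fin m))) [SigmaFinite μ]
    (p : Θ → EuclideanSpace ℝ (Fin m) → ℝ≥0)
    (hp_meas : Measurable (Function.uncurry p))
    (hp_density : ∀ θ : Θ, ∫⁻ x, (p θ x : ℝ≥0∞) ∂μ = 1)
    (g₀ : ProbabilityMeasure Θ)
    (hΘ : Bornology.IsBounded Θ)
    (hID : ∀ g : ProbabilityMeasure Θ,
      NPMLE.chiSq μ (NPMLE.mixDensity p g) (NPMLE.mixDensity p g₀) = 0 ↔ g = g₀)
    (hg₀ : ¬ NPMLE.FinitelyDiscrete g₀)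
    {Ω : Type*} [MeasurableSpace Ω] (P : Measure Ω) [IsProbabilityMeasure P]
    (X : ℕ → Ω → EuclideanSpace ℝ (Fin m))
    (hX_meas : ∀ i, Measurable (X i))
    (hX_indep : iIndepFun X P)
    (hX_law : ∀ i, P.map (X i) = μ.withDensity (NPMLE.mixDensity p g₀))
    (ghat : ℕ → Ω → ProbabilityMeasure Θ)
    (hghat : ∀ n ω, (∃ g, NPMLE.IsNPMLE p (fun i => X i ω) n g) →
      NPMLE.IsNPMLE p (fun i => X i ω) n (ghat n ω)) :
    (∀ c : ℝ, 0 < c →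
      NPMLE.TendstoInftyInProb P (fun n ω =>
        ((⨆ g ∈ NPMLE.largeLik p g₀ (fun i => X i ω) n c (ghat n ω),
          (n : ℝ≥0∞) * NPMLE.chiSq μ (NPMLE.mixDensity p g) (NPMLE.mixDensity p g₀) : ℝ≥0∞) :
            EReal))) ∧
    NPMLE.TendstoInftyInProb P (fun n ω => NPMLE.lrStat p g₀ (fun i => X i ω) n) := by
  have hmain := fun (c r : ℝ) (hr : 0 < r) (ε : ℝ) (hε : 0 < ε) =>
    NPMLE.eventually_exists_large_logLik hp_meas hp_density (fun g => (hID g).1) hg₀ hX_meas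
      hX_indep hX_law c hr hε
  have hlim : ∀ {f : ℕ → ℝ≥0∞},
      (∀ ε : ℝ, 0 < ε → ∀ᶠ n in atTop, f n ≤ ENNReal.ofReal ε) → Tendsto f atTop (𝓝 0) := by
    intro f hf
    refine ENNReal.tendsto_nhds_zero.2 fun ε hε => ?_
    obtain ⟨δ, hδ, hδε⟩ := ENNReal.lt_iff_exists_nnreal_btwn.1 hε
    filter_upwards [hf δ (by exact_mod_cast hδ)] with n hn
    exact hn.trans (by simpa using hδε.le)
  refine ⟨fun c _ M => hlim fun ε hε => ?_, fun M => hlim fun ε hε => ?_⟩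
  · -- A radius with `r ^ 2 > M`.
    have hr : 0 < |M| + 1 := by positivity
    filter_upwards [hmain c (|M| + 1) hr ε hε] with n hn
    refine (measure_mono fun ω hω => ?_).trans hn
    rintro ⟨g, a, ha, hag, hchi⟩
    have hmem : g ∈ NPMLE.largeLik p g₀ (fun i => X i ω) n c (ghat n ω) := by
      refine Or.inl ?_
      rw [Set.mem_ofPred_eq, ha, ← EReal.coe_add]
      exact hag
    have h1 : ENNReal.ofReal ((|M| + 1) ^ 2) ≤
        ⨆ g ∈ NPMLE.largeLik p g₀ (fun i => X i ω) n c (ghat n ω),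
          (n : ℝ≥0∞) * NPMLE.chiSq μ (NPMLE.mixDensity p g) (NPMLE.mixDensity p g₀) :=
      hchi ▸ le_iSup₂_of_le (f := fun g (_ : g ∈ NPMLE.largeLik p g₀ (fun i => X i ω) n c
        (ghat n ω)) => (n : ℝ≥0∞) * NPMLE.chiSq μ (NPMLE.mixDensity p g)
          (NPMLE.mixDensity p g₀)) g hmem le_rfl
    have h2 := (EReal.coe_ennreal_le_coe_ennreal_iff.2 h1).trans hω
    rw [EReal.coe_ennreal_ofReal, max_eq_left (by positivity), EReal.coe_le_coe_iff] at h2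
    nlinarith [le_abs_self M, abs_nonneg M]
  · -- A gain `c` with `2 * c > M`.
    filter_upwards [hmain (|M| + 1) 1 one_pos ε hε] with n hn
    refine (measure_mono fun ω hω => ?_).trans hn
    rintro ⟨g, a, ha, hag, -⟩
    have h1 : ((|M| + 1 : ℝ) : EReal)
        ≤ (⨆ g, NPMLE.logLik (fun i => X i ω) n (NPMLE.mixDensity p g)) - (a : EReal) := by
      have h3 := EReal.sub_le_sub (hag.trans
        (le_iSup (fun g => NPMLE.logLik (fun i => X i ω) n (NPMLE.mixDensity p g)) g))
        (le_refl (a : EReal))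
      rw [← EReal.coe_sub, add_sub_cancel_left] at h3
      exact h3
    have h2 : ((2 * (|M| + 1) : ℝ) : EReal) ≤ (M : EReal) := by
      refine le_trans ?_ hω
      rw [NPMLE.lrStat, ha, EReal.coe_mul]
      exact mul_le_mul_of_nonneg_left h1 (by norm_num)
    rw [EReal.coe_le_coe_iff] at h2
    linarith [le_abs_self M, abs_nonneg M]
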